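/- **Theorem.** Let $A,B\subseteq\mathbb R^n$ be non-empty closed sets, let $\iota_A,\iota_B$ be their indicator functions (value $0$ on the set, $+\infty$ outside), and put $$L(x,y)=\tfrac12\|x-y\|^2+\iota_A(x)+\iota_B(y),\qquad F(x,y,\rho)=L(x,y)+\tfrac12\rho^2\qquad (x,y\in\mathbb R^n,\ \rho\in\mathbb R).$$ Write $\mathcal P_A(z)=\operatorname{argmin}_{u\in A}\|u-z\|$ and $\mathcal P_B(z)=\operatorname{argmin}_{u\in B}\|u-z\|$ for the set-valued Euclidean projections. Let $(x^k,y^k)_{k\ge0}$ be generated by the inexact regularized alternating projection method (iRAPM): $(x^0,y^0)\in A\times B$, $0<\lambda_-<\lambda_+$, $0<\mu_-<\mu_+$, $\lambda_k\in[\lambda_-,\lambda_+]$, $\mu_k\in[\mu_-,\mu_+]$, $\zeta\in(0,1]$, and for every $k\ge 0$ $$x^{k+1}\in\mathcal P_A\Big(\tfrac{1}{\lambda_k+1}x^k+\tfrac{\lambda_k}{\lambda_k+1}y^k\Big),$$ while $y^{k+1}\in B$ is such that, for some $\hat y^{k+1}\in\mathcal P_B\big(\tfrac{1}{\mu_k+1}y^k+\tfrac{\mu_k}{\mu_k+1}x^{k+1}\big)$,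 $$Q^{k+1}(y^{k+1})\le\zeta\,Q^{k+1}(\hat y^{k+1}),\qquad \|y^{k+1}-\hat y^{k+1}\|\le\sqrt{-\tfrac{1-\zeta}{\zeta}\,Q^{k+1}(y^{k+1})},$$ where $Q^{k+1}(y)=\tfrac1{2\mu_k}\|y-y^k\|^2+L(x^{k+1},y)-L(x^{k+1},y^k)$. For a function $f$ with values in $[-\infty,+\infty]$, let $\hat\partial f(z)$ be the Fréchet subdifferential at a point where $f$ is finite, that is, the set of all $w$ with $\liminf_{u\to z,\,u\ne z}\frac{f(u)-f(z)-\langle w,u-z\rangle}{\|u-z\|}\ge0$; let $\partial f(z)$ be the limiting subdifferential, that is, the set of limits of $w^j\in\hat\partial f(z^j)$ with $z^j\to z$ and $f(z^j)\to f(z)$ (both sets are empty where $f$ is not finite); and let $\|\partial f(z)\|_-=\inf_{v\in\partial f(z)}\|v\|$, with $\inf\emptyset=+\infty$. Suppose that $(x^k,y^k)$ converges to a point $(x^*,y^*)\in A\times B$ and that $F$ has the Kurdyka–Łojasiewicz property at $z^*=(x^*,y^*,0)$ with $\phi(t)=c\,t^{1-\theta}$, $c>0$, $\theta\in[0,1)$;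 that is, $\partial F(z^*)\neq\emptyset$ and there are $\upsilon\in(0,+\infty]$ and a neighbourhood $U$ of $z^*$ such that $$\phi'\big(F(z)-F(z^*)\big)\,\|\partial F(z)\|_-\ge1\qquad\text{for all } z\in U \text{ with } F(z^*)<F(z)<F(z^*)+\upsilon .$$ Then: (i) if $\theta=0$, the sequence terminates after finitely many iterations: there is $N$ with $(x^k,y^k)=(x^*,y^*)$ for all $k\ge N$; (ii) if $\theta\in(0,\tfrac12]$, there are $C>0$ and $\tau\in(0,1)$ with $\|(x^k,y^k)-(x^*,y^*)\|\le C\tau^k$ for all $k\ge0$; (iii) if $\theta\in(\tfrac12,1)$, there is $C>0$ with $\|(x^k,y^k)-(x^*,y^*)\|\le C\,k^{-\frac{1-\theta}{2\theta-1}}$ for all $k\ge1$. -/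

import Mathlib

open Set Filter Topology

noncomputable section

namespace IRAPM

/-! ### Variational analysis of extended-real-valued functions -/

section Variational

variable {V : Type*} [NormedAddCommGroup V] [InnerProductSpace ℝ V]

/-- Fréchet subdifferential of `f` at `x`. It is empty unless `f x` is finite. -/
def frechetSubdiff (f : V → EReal) (x : V) : Set V :=
  {w | f x ≠ ⊤ ∧ f x ≠ ⊥ ∧
    0 ≤ liminf (fun z : V => (f z - f x - ((inner ℝ w (z - x) : ℝ) : EReal)) /
      ((‖z - x‖ : ℝ) : EReal)) (𝓝[≠] x)}

/-- Limiting subdifferential of `f` at `x`. It is empty unless `f x` is finite. -/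
def limitingSubdiff (f : V → EReal) (x : V) : Set V :=
  {w | f x ≠ ⊤ ∧ f x ≠ ⊥ ∧
    ∃ u v : ℕ → V, Tendsto u atTop (𝓝 x) ∧ Tendsto (fun k => f (u k)) atTop (𝓝 (f x)) ∧
      (∀ k, v k ∈ frechetSubdiff f (u k)) ∧ Tendsto v atTop (𝓝 w)}

/-- Lazy slope: the infimum of the norms of the limiting subgradients at `x`
(`+∞` if there are none). -/
def lazySlope (f : V → EReal) (x : V) : ENNReal :=
  ⨅ v ∈ limitingSubdiff f x, ‖v‖ₑ

/-- `φ`, regarded as a function on `[0, υ)`, is a desingularizing function: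
nonnegative, continuous and concave on `[0, υ)`, zero at zero, of class `C¹` on `(0, υ)` with
positive derivative there. -/
structure IsDesingularizing (υ : EReal) (φ : ℝ → ℝ) : Prop where
  nonneg : ∀ t : ℝ, 0 ≤ t → (t : EReal) < υ → 0 ≤ φ t
  continuousOn : ContinuousOn φ {t : ℝ | 0 ≤ t ∧ (t : EReal) < υ}
  concaveOn : ConcaveOn ℝ {t : ℝ | 0 ≤ t ∧ (t : EReal) < υ} φ
  map_zero : φ 0 = 0
  contDiffOn : ContDiffOn ℝ 1 φ {t : ℝ | 0 < t ∧ (t : EReal) < υ}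
  deriv_pos : ∀ t : ℝ, 0 < t → (t : EReal) < υ → 0 < deriv φ t

/-- The Kurdyka–Łojasiewicz property of `f` at `x ∈ dom ∂f` with desingularizing function `φ`
(restricted to some interval `[0, υ)` with `υ ∈ (0, +∞]`). -/
def HasKLPropertyWith (f : V → EReal) (x : V) (φ : ℝ → ℝ) : Prop :=
  (limitingSubdiff f x).Nonempty ∧
  ∃ υ : EReal, 0 < υ ∧ IsDesingularizing υ φ ∧
  ∃ U ∈ 𝓝 x, ∀ z ∈ U, f x < f z → f z < f x + υ →
    1 ≤ ENNReal.ofReal (deriv φ (f z - f x).toReal) * lazySlope f z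

end Variational

/-! ### The feasibility problem, the merit function and the algorithm -/

/-- The indicator function of a set, with values `0` and `+∞`. -/
def indicatorFn {X : Type*} (A : Set X) (x : X) : EReal :=
  open Classical in if x ∈ A then 0 else ⊤

section Algorithm

variable {n : ℕ}

/-- The (set-valued) projection onto `A`. -/
def proj (A : Set (EuclideanSpace ℝ (Fin n))) (x : EuclideanSpace ℝ (Fin n)) :
    Set (EuclideanSpace ℝ (Fin n)) :=
  {y | y ∈ A ∧ IsMinOn (fun z => (1 / 2 : ℝ) * ‖z - x‖ ^ 2) A y}

/-- The objective `L(x, y) = ½‖x - y‖² + ι_A(x) + ι_B(y)`. -/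
def objective (A B : Set (EuclideanSpace ℝ (Fin n))) (x y : EuclideanSpace ℝ (Fin n)) : EReal :=
  (((1 / 2 : ℝ) * ‖x - y‖ ^ 2 : ℝ) : EReal) + indicatorFn A x + indicatorFn B y

/-- The space `ℝⁿ × ℝⁿ` with the Euclidean norm. -/
abbrev Pair (n : ℕ) : Type :=
  WithLp 2 (EuclideanSpace ℝ (Fin n) × EuclideanSpace ℝ (Fin n))

/-- The space `(ℝⁿ × ℝⁿ) × ℝ` with the Euclidean norm. -/
abbrev Triple (n : ℕ) : Type :=
  WithLp 2 (Pair n × ℝ)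

/-- The element `(x, y)` of `ℝⁿ × ℝⁿ`. -/
def mkPair (x y : EuclideanSpace ℝ (Fin n)) : Pair n :=
  WithLp.toLp 2 (x, y)

/-- The element `(x, y, ρ)` of `ℝⁿ × ℝⁿ × ℝ`. -/
def mkTriple (x y : EuclideanSpace ℝ (Fin n)) (ρ : ℝ) : Triple n :=
  WithLp.toLp 2 (mkPair x y, ρ)

/-- The merit function `F(x, y, ρ) = L(x, y) + ½ρ²`. -/
def merit (A B : Set (EuclideanSpace ℝ (Fin n))) (z : Triple n) : EReal :=
  objective A B z.fst.fst z.fst.snd + (((1 / 2 : ℝ) * z.snd ^ 2 : ℝ) : EReal)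

/-- The function `Q^{k+1}(v) = ‖v - yᵏ‖² / (2μ) + L(xᵏ⁺¹, v) - L(xᵏ⁺¹, yᵏ)`. -/
def Qfun (A B : Set (EuclideanSpace ℝ (Fin n))) (μ : ℝ) (xnext ycur v : EuclideanSpace ℝ (Fin n)) :
    EReal :=
  ((1 / (2 * μ) * ‖v - ycur‖ ^ 2 : ℝ) : EReal) + objective A B xnext v - objective A B xnext ycur

/-- The regularized point `(y + μ x) / (μ + 1)`. -/
def regPoint (μ : ℝ) (y x : EuclideanSpace ℝ (Fin n)) : EuclideanSpace ℝ (Fin n) :=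
  (1 / (μ + 1)) • y + (μ / (μ + 1)) • x

/-- `(xᵏ)` and `(yᵏ)` are generated by the inexact regularized alternating projection method on
`A` and `B` with parameters `(λ_k)`, `(μ_k)` and `ζ`. In each iteration, `yᵏ⁺¹ ∈ B` satisfies the two
inexactness conditions with respect to some exact projection `yhat`. In the second condition `Q` is
finite, since `xᵏ⁺¹ ∈ A` and `yᵏ, yᵏ⁺¹ ∈ B`. -/
structure IsGenerated (A B : Set (EuclideanSpace ℝ (Fin n))) (lam mu : ℕ → ℝ) (ζ : ℝ)
    (x y : ℕ → EuclideanSpace ℝ (Fin n)) : Prop where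
  x_zero : x 0 ∈ A
  y_zero : y 0 ∈ B
  lam_bounds : ∃ lo hi : ℝ, 0 < lo ∧ lo < hi ∧ ∀ k, lam k ∈ Icc lo hi
  mu_bounds : ∃ lo hi : ℝ, 0 < lo ∧ lo < hi ∧ ∀ k, mu k ∈ Icc lo hi
  zeta_mem : ζ ∈ Ioc (0 : ℝ) 1
  step_x : ∀ k, x (k + 1) ∈ proj A (regPoint (lam k) (x k) (y k))
  step_y : ∀ k, y (k + 1) ∈ B ∧ ∃ yhat ∈ proj B (regPoint (mu k) (y k) (x (k + 1))),
    Qfun A B (mu k) (x (k + 1)) (y k) (y (k + 1)) ≤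
      (ζ : EReal) * Qfun A B (mu k) (x (k + 1)) (y k) yhat ∧
    ‖y (k + 1) - yhat‖ ≤
      √(-((1 - ζ) / ζ * (Qfun A B (mu k) (x (k + 1)) (y k) (y (k + 1))).toReal))

end Algorithm

end IRAPM

end

/-! An inexact y^{k+1} gives no control on subgradients at (x^{k+1}, y^{k+1}). The exact projection
ŷ^{k+1} does, but L may be lower there. The third variable of F repairs this: at (x^{k+1}, ŷ^{k+1},
ρ), with ρ² filling the gap, F equals L(x^{k+1}, y^{k+1}) + e with e ≥ 0 small, and has a
subgradient of norm O(√D), where D adds -Q^{k+1}(y^{k+1}) to the squared steps. The decrease of L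
pays for this same D (`iteration_estimates`).

With r_k = L(x^k, y^k) - L(x*, y*) and d_k = √D_k, this yields r_{k+1} + a d_k² ≤ r_k and, by the KL
property, r_{k+1}^θ ≤ M d_k for large k (`IsGenerated.exists_lojasiewiczDescent`). The rates follow
from these two inequalities alone. They bound the distance to the limit by a multiple of √r_k +
r_k^{1-θ} (`exists_dist_le`) and, for θ > 0, give r_{k+1}^{2θ} ≤ Λ (r_k - r_{k+1}) (`rpow_le`):
geometric decay of r if θ ≤ 1/2, a power law beyond. If θ = 0, d_k stays above 1/M until r vanishes.
-/

namespace IRAPM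

/-! ### Rates for abstract descent sequences -/

section Rates

/-- Tangent of the concave t^{1-θ} at u, via Bernoulli at v/u - 1. Multiplying by u^θ produces
exactly the quantity that the Łojasiewicz inequality bounds. -/
theorem rpow_tangent_le {θ u v : ℝ} (hθ : θ ∈ Ico (0 : ℝ) 1) (hu : 0 < u) (hv : 0 ≤ v) :
    (1 - θ) * (u - v) ≤ u ^ θ * (u ^ (1 - θ) - v ^ (1 - θ)) := by
  have hs : -1 ≤ v / u - 1 := by have := div_nonneg hv hu.le; linarith
  have h := rpow_one_add_le_one_add_mul_self hs (p := 1 - θ) (by linarith [hθ.2])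
    (by linarith [hθ.1])
  rw [add_sub_cancel, Real.div_rpow hv hu.le] at h
  have hpos : 0 < u ^ (1 - θ) := Real.rpow_pos_of_pos hu _
  rw [div_le_iff₀ hpos] at h
  have hmul : u ^ θ * u ^ (1 - θ) = u := by
    rw [← Real.rpow_add hu, add_sub_cancel, Real.rpow_one]
  have h2 := mul_le_mul_of_nonneg_left h (Real.rpow_nonneg hu.le θ)
  have h3 : u ^ θ * ((1 + (1 - θ) * (v / u - 1)) * u ^ (1 - θ))
      = u + (1 - θ) * (v - u) := by
    rw [mul_left_comm, hmul]; field_simp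
  rw [mul_sub (u ^ θ), hmul]
  linarith

/-- Each step is paid for by a drop of V, so path lengths telescope; then the endpoint goes to the
limit. -/
theorem dist_limit_le_of_potential {X : Type*} [PseudoMetricSpace X] {u : ℕ → X} {us : X}
    (hu : Tendsto u atTop (𝓝 us)) {V : ℕ → ℝ} {k₀ : ℕ} (hV : ∀ k, 0 ≤ V k)
    (h : ∀ k ≥ k₀, dist (u k) (u (k + 1)) + V (k + 1) ≤ V k) {k : ℕ} (hk : k₀ ≤ k) :
    dist (u k) us ≤ V k := by
  have key : ∀ m ≥ k, dist (u k) (u m) + V m ≤ V k := by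
    intro m hm
    induction m, hm using Nat.le_induction with
    | base => simp
    | succ m hm ih =>
      have := dist_triangle (u k) (u m) (u (m + 1))
      linarith [h m (hk.trans hm)]
  refine le_of_tendsto (tendsto_const_nhds.dist hu) ?_
  filter_upwards [eventually_ge_atTop k] with m hm
  linarith [key m hm, hV m]

theorem exists_forall_le_mul_of_eventually {f g : ℕ → ℝ} {C : ℝ} {m : ℕ}
    (hg : ∀ k ≥ m, 0 < g k) (h : ∀ᶠ k in atTop, f k ≤ C * g k) :
    ∃ C' > (0 : ℝ), ∀ k ≥ m, f k ≤ C' * g k := by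
  obtain ⟨N, hN⟩ := eventually_atTop.1 h
  have hsum : ∀ k, 0 ≤ |f k / g k| := fun _ => abs_nonneg _
  refine ⟨|C| + 1 + ∑ i ∈ Finset.range N, |f i / g i|, ?_, fun k hk => ?_⟩
  · have := Finset.sum_nonneg (s := Finset.range N) fun i _ => hsum i
    positivity
  · have hS := Finset.sum_nonneg (s := Finset.range N) fun i _ => hsum i
    have hgk := hg k hk
    rcases le_or_gt N k with hNk | hNk
    · refine (hN k hNk).trans (mul_le_mul_of_nonneg_right ?_ hgk.le)
      linarith [le_abs_self C]
    · rw [← div_le_iff₀ hgk]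
      have := Finset.single_le_sum (fun i _ => hsum i) (Finset.mem_range.2 hNk)
      linarith [le_abs_self (f k / g k), abs_nonneg C]

/-- One step of the recursion `u + u ^ (p + 1) / M ≤ v` increases `· ^ (-p)` by a fixed amount. -/
theorem rpow_recursion_step {p M u v s : ℝ} (hp : p ∈ Ioo (0 : ℝ) 1) (hM : 0 < M) (hu : 0 ≤ u)
    (hsmall : u ^ p ≤ M) (h : u ^ (p + 1) ≤ M * (v - u)) (hs : s * v ^ p ≤ 1) :
    (s + p / (2 * M)) * u ^ p ≤ 1 := by
  rcases hu.eq_or_lt with rfl | hu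
  · simp [Real.zero_rpow hp.1.ne']
  set w := u ^ p with hw
  have hwpos : 0 < w := Real.rpow_pos_of_pos hu p
  set σ := w / M with hσ
  have hσpos : 0 < σ := div_pos hwpos hM
  have hσ1 : σ ≤ 1 := (div_le_one hM).2 hsmall
  have hv : u * (1 + σ) ≤ v := by
    rw [Real.rpow_add hu, Real.rpow_one] at h
    have : u * σ ≤ v - u := by
      rw [hσ, ← mul_div_assoc, div_le_iff₀ hM]; linarith
    linarith
  have hvp : w * (1 + σ) ^ p ≤ v ^ p := by
    rw [hw, ← Real.mul_rpow hu.le (by positivity)]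
    exact Real.rpow_le_rpow (by positivity) hv hp.1.le
  -- Bernoulli at -σ/(1+σ); the factor 1/2 comes from σ ≤ 1, which is what `hsmall` provides.
  have hB : (1 + σ)⁻¹ ^ p ≤ 1 - p * σ / 2 := by
    have h1 : (1 + σ)⁻¹ = 1 + -(σ / (1 + σ)) := by field_simp; ring
    have h2 : σ / (1 + σ) ≤ 1 := (div_le_one (by positivity)).2 (by linarith)
    have h3 : σ / 2 ≤ σ / (1 + σ) := by gcongr; linarith
    have := rpow_one_add_le_one_add_mul_self (s := -(σ / (1 + σ))) (by linarith) hp.1.le hp.2.le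
    rw [h1]
    nlinarith [hp.1]
  rw [Real.inv_rpow (by positivity)] at hB
  have hpos : 0 < (1 + σ) ^ p := Real.rpow_pos_of_pos (by positivity) _
  have hpw : p / (2 * M) * w = p * σ / 2 := by rw [hσ]; field_simp
  rw [add_mul, hpw]
  rcases le_or_gt s 0 with hs0 | hs0
  · nlinarith [hp.1, hp.2]
  · have h1 : s * w * (1 + σ) ^ p ≤ 1 := by nlinarith
    have h2 : s * w ≤ ((1 + σ) ^ p)⁻¹ := by
      rw [← one_div, le_div_iff₀ hpos]; exact h1
    linarith

variable {X : Type*} [MetricSpace X]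

/-- The data to which the convergence rate analysis applies: a convergent sequence `u`, with step
bounds `d`, a decreasing residual `r`, and a Łojasiewicz inequality. -/
structure LojasiewiczDescent (u : ℕ → X) (us : X) (r d : ℕ → ℝ) (a M θ : ℝ) (k₀ : ℕ) : Prop where
  tendsto : Tendsto u atTop (𝓝 us)
  dist_le : ∀ k, dist (u k) (u (k + 1)) ≤ d k
  r_nonneg : ∀ k, 0 ≤ r k
  d_nonneg : ∀ k, 0 ≤ d k
  a_pos : 0 < a
  M_pos : 0 < M
  descent : ∀ k, r (k + 1) + a * d k ^ 2 ≤ r k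
  r_tendsto : Tendsto r atTop (𝓝 0)
  theta_mem : θ ∈ Ico (0 : ℝ) 1
  lojasiewicz : ∀ k ≥ k₀, 0 < r (k + 1) → r (k + 1) ^ θ ≤ M * d k

namespace LojasiewiczDescent

variable {u : ℕ → X} {us : X} {r d : ℕ → ℝ} {a M θ : ℝ} {k₀ : ℕ}

theorem antitone (h : LojasiewiczDescent u us r d a M θ k₀) : Antitone r :=
  antitone_nat_of_succ_le fun k => by
    linarith [h.descent k, mul_nonneg h.a_pos.le (sq_nonneg (d k))]

theorem sq_le (h : LojasiewiczDescent u us r d a M θ k₀) (k : ℕ) : d k ^ 2 ≤ r k / a := by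
  rw [le_div_iff₀ h.a_pos]
  linarith [h.descent k, h.r_nonneg (k + 1)]

theorem d_tendsto (h : LojasiewiczDescent u us r d a M θ k₀) : Tendsto d atTop (𝓝 0) := by
  have h1 : Tendsto (fun k => √(r k / a)) atTop (𝓝 0) := by
    simpa using (h.r_tendsto.div_const a).sqrt
  exact squeeze_zero h.d_nonneg (fun k => Real.le_sqrt_of_sq_le (h.sq_le k)) h1

theorem finite_termination (h : LojasiewiczDescent u us r d a M θ k₀) (hθ : θ = 0) :
    ∃ N, ∀ k ≥ N, u k = us := by
  have hN : ∃ N, r N = 0 := by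
    by_contra! hne
    have h1 : ∀ᶠ k in atTop, 1 / M ≤ d k := by
      filter_upwards [eventually_ge_atTop k₀] with k hk
      have := h.lojasiewicz k hk ((h.r_nonneg _).lt_of_ne' (hne _))
      rw [hθ, Real.rpow_zero] at this
      rw [div_le_iff₀ h.M_pos]; linarith
    have := ge_of_tendsto h.d_tendsto h1
    have hM := h.M_pos
    have : 0 < 1 / M := by positivity
    linarith
  obtain ⟨N, hN⟩ := hN
  refine ⟨N, fun k hk => ?_⟩
  have hr : ∀ m ≥ N, r m = 0 := fun m hm =>
    le_antisymm ((h.antitone hm).trans hN.le) (h.r_nonneg m)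
  have hd : ∀ m ≥ N, d m = 0 := fun m hm => by
    have := h.sq_le m
    rw [hr m hm, zero_div] at this
    exact pow_eq_zero_iff two_ne_zero |>.1 (le_antisymm this (sq_nonneg _))
  have := dist_limit_le_of_potential h.tendsto (V := fun _ => 0) (k₀ := N) (fun _ => le_rfl)
    (fun m hm => by simpa [hd m hm] using h.dist_le m) hk
  exact dist_le_zero.1 this

theorem rpow_le (h : LojasiewiczDescent u us r d a M θ k₀) (hθ : 0 < θ) {k : ℕ} (hk : k₀ ≤ k) :
    r (k + 1) ^ (2 * θ) ≤ M ^ 2 / a * (r k - r (k + 1)) := by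
  have h1 : r (k + 1) ^ θ ≤ M * d k := by
    rcases (h.r_nonneg (k + 1)).eq_or_lt with h0 | h0
    · rw [← h0, Real.zero_rpow hθ.ne']; exact mul_nonneg h.M_pos.le (h.d_nonneg k)
    · exact h.lojasiewicz k hk h0
  have h2 : r (k + 1) ^ (2 * θ) = (r (k + 1) ^ θ) ^ 2 := by
    rw [mul_comm, Real.rpow_mul (h.r_nonneg _)]; norm_cast
  have ha := h.a_pos
  rw [h2, div_mul_eq_mul_div, le_div_iff₀ ha]
  calc (r (k + 1) ^ θ) ^ 2 * a ≤ (M * d k) ^ 2 * a := by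
        gcongr; exact Real.rpow_nonneg (h.r_nonneg _) _
    _ = M ^ 2 * (a * d k ^ 2) := by ring
    _ ≤ _ := by gcongr; linarith [h.descent k]

/-- Concavity of t^{1-θ} bounds d_{k+1}² by d_k times a telescoping difference. AM-GM turns this
into a linear inequality, for which d_k + K r_{k+1}^{1-θ} is a potential. Descent then gives d_k ≤
√(r_k / a). -/
theorem exists_dist_le (h : LojasiewiczDescent u us r d a M θ k₀) :
    ∃ K > (0 : ℝ), ∀ k ≥ k₀, dist (u (k + 1)) us ≤ K * (r k ^ (1 / 2 : ℝ) + r k ^ (1 - θ)) := by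
  have ha := h.a_pos
  have hM := h.M_pos
  have hθ : 0 < 1 - θ := by linarith [h.theta_mem.2]
  set K := M / (a * (1 - θ)) with hK
  have hKpos : 0 < K := by positivity
  have hmono : ∀ k, r (k + 1) ^ (1 - θ) ≤ r k ^ (1 - θ) := fun k =>
    Real.rpow_le_rpow (h.r_nonneg _) (h.antitone k.le_succ) hθ.le
  have key : ∀ k ≥ k₀, 2 * d (k + 1) ≤
      d k + K * (r (k + 1) ^ (1 - θ) - r (k + 2) ^ (1 - θ)) := by
    intro k hk
    have hg : 0 ≤ K * (r (k + 1) ^ (1 - θ) - r (k + 2) ^ (1 - θ)) :=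
      mul_nonneg hKpos.le (sub_nonneg.2 (hmono (k + 1)))
    have hsq : d (k + 1) ^ 2 ≤ d k * (K * (r (k + 1) ^ (1 - θ) - r (k + 2) ^ (1 - θ))) := by
      rcases (h.r_nonneg (k + 1)).eq_or_lt with h0 | h0
      · have := h.sq_le (k + 1)
        rw [← h0, zero_div] at this
        exact this.trans (mul_nonneg (h.d_nonneg k) hg)
      · have h1 := rpow_tangent_le h.theta_mem h0 (h.r_nonneg (k + 2))
        have h2 := mul_le_mul_of_nonneg_right (h.lojasiewicz k hk h0)
          (sub_nonneg.2 (hmono (k + 1)))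
        have h3 := mul_le_mul_of_nonneg_left
          (show a * d (k + 1) ^ 2 ≤ r (k + 1) - r (k + 2) by linarith [h.descent (k + 1)]) hθ.le
        have h4 : (a * (1 - θ)) * d (k + 1) ^ 2 ≤
            M * d k * (r (k + 1) ^ (1 - θ) - r (k + 2) ^ (1 - θ)) := by linarith
        rw [hK, show d k * (M / (a * (1 - θ)) * (r (k + 1) ^ (1 - θ) - r (k + 2) ^ (1 - θ))) =
          (M * d k * (r (k + 1) ^ (1 - θ) - r (k + 2) ^ (1 - θ))) / (a * (1 - θ)) by ring,
          le_div_iff₀ (by positivity)]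
        linarith
    nlinarith [h.d_nonneg k, h.d_nonneg (k + 1),
      sq_nonneg (d k - K * (r (k + 1) ^ (1 - θ) - r (k + 2) ^ (1 - θ)))]
  have hdist : ∀ k ≥ k₀, dist (u (k + 1)) us ≤ d k + K * r (k + 1) ^ (1 - θ) := by
    intro k hk
    refine dist_limit_le_of_potential (u := fun k => u (k + 1)) (k₀ := k₀)
      (V := fun k => d k + K * r (k + 1) ^ (1 - θ)) ((tendsto_add_atTop_iff_nat 1).2 h.tendsto)
      (fun k => ?_) (fun k hk => ?_) hk
    · have := Real.rpow_nonneg (h.r_nonneg (k + 1)) (1 - θ)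
      have := h.d_nonneg k
      positivity
    · have h1 := key k hk
      have h2 := h.dist_le (k + 1)
      rw [mul_sub] at h1
      show dist (u (k + 1)) (u (k + 1 + 1)) + (d (k + 1) + K * r (k + 1 + 1) ^ (1 - θ)) ≤ _
      linarith
  refine ⟨1 / √a + K, by positivity, fun k hk => (hdist k hk).trans ?_⟩
  have h1 : d k ≤ 1 / √a * r k ^ (1 / 2 : ℝ) := by
    rw [← Real.sqrt_eq_rpow, one_div_mul_eq_div, ← Real.sqrt_div (h.r_nonneg k)]
    exact Real.le_sqrt_of_sq_le (h.sq_le k)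
  have h2 := mul_le_mul_of_nonneg_left (hmono k) hKpos.le
  have h3 := Real.rpow_nonneg (h.r_nonneg k) (1 / 2)
  have h4 := Real.rpow_nonneg (h.r_nonneg k) (1 - θ)
  have h5 : 0 < 1 / √a := by positivity
  nlinarith [mul_nonneg hKpos.le h3, mul_nonneg h5.le h4]

theorem eventually_r_le (h : LojasiewiczDescent u us r d a M θ k₀) {ε : ℝ} (hε : 0 < ε) :
    ∃ N ≥ k₀, ∀ k ≥ N, r k ≤ ε := by
  obtain ⟨N, hN⟩ := eventually_atTop.1 (h.r_tendsto.eventually_le_const hε)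
  exact ⟨max N k₀, le_max_right _ _, fun k hk => hN k ((le_max_left _ _).trans hk)⟩

theorem linear_rate (h : LojasiewiczDescent u us r d a M θ k₀) (hθ : θ ∈ Ioc (0 : ℝ) (1 / 2)) :
    ∃ C > (0 : ℝ), ∃ τ ∈ Ioo (0 : ℝ) 1, ∀ k, dist (u k) us ≤ C * τ ^ k := by
  obtain ⟨K, hK, hdist⟩ := h.exists_dist_le
  obtain ⟨N, hNk, hN⟩ := h.eventually_r_le one_pos
  have ha := h.a_pos
  have hM := h.M_pos
  set Λ := M ^ 2 / a with hΛ
  have hΛpos : 0 < Λ := by positivity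
  set σ := Λ / (1 + Λ) with hσ
  have hσpos : 0 < σ := by positivity
  have hσ1 : σ < 1 := (div_lt_one (by positivity)).2 (by linarith)
  have hstep : ∀ k ≥ N, r (k + 1) ≤ σ * r k := by
    intro k hk
    have h1 := h.rpow_le hθ.1 (hNk.trans hk)
    -- Here θ ≤ 1/2 enters: once r ≤ 1, the recursion is at least as strong as a linear one.
    have h2 : r (k + 1) ≤ r (k + 1) ^ (2 * θ) :=
      Real.self_le_rpow_of_le_one (h.r_nonneg _) (hN _ (hk.trans k.le_succ)) (by linarith [hθ.2])
    rw [hσ, div_mul_eq_mul_div, le_div_iff₀ (by positivity)]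
    linarith
  have hgeom : ∀ k, r (N + k) ≤ σ ^ k := by
    intro k
    induction k with
    | zero => simpa using hN N le_rfl
    | succ k ih =>
      calc r (N + k + 1) ≤ σ * r (N + k) := hstep _ (Nat.le_add_right _ _)
        _ ≤ σ * σ ^ k := by gcongr
        _ = σ ^ (k + 1) := by ring
  set τ := √σ with hτ
  have hτpos : 0 < τ := Real.sqrt_pos.2 hσpos
  have hτ1 : τ < 1 := by rw [hτ, Real.sqrt_lt' one_pos]; simpa using hσ1
  have hev : ∀ᶠ k in atTop, dist (u k) us ≤ 2 * K / τ ^ (N + 1) * τ ^ k := by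
    filter_upwards [eventually_ge_atTop (N + 1)] with k hk
    obtain ⟨j, rfl⟩ := Nat.exists_eq_add_of_le hk
    have hle : N ≤ N + j := Nat.le_add_right _ _
    have h1 := hdist (N + j) (hNk.trans hle)
    have hhalf : r (N + j) ^ (1 / 2 : ℝ) ≤ τ ^ j := by
      rw [← Real.sqrt_eq_rpow]
      refine Real.sqrt_le_iff.2 ⟨by positivity, ?_⟩
      rw [← pow_mul, mul_comm, pow_mul, hτ, Real.sq_sqrt hσpos.le]
      exact hgeom j
    have hexp : r (N + j) ^ (1 - θ) ≤ r (N + j) ^ (1 / 2 : ℝ) := by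
      rcases (h.r_nonneg (N + j)).eq_or_lt with h0 | h0
      · rw [← h0, Real.zero_rpow (by linarith [hθ.2]), Real.zero_rpow (by norm_num)]
      · exact Real.rpow_le_rpow_of_exponent_ge h0 (hN _ hle) (by linarith [hθ.2])
    rw [show N + 1 + j = N + j + 1 by ring]
    calc dist (u (N + j + 1)) us ≤ _ := h1
      _ ≤ K * (τ ^ j + τ ^ j) := by gcongr; exact hexp.trans hhalf
      _ = _ := by field_simp; ring
  obtain ⟨C, hC, hall⟩ := exists_forall_le_mul_of_eventually (m := 0)
    (fun k _ => pow_pos hτpos k) hev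
  exact ⟨C, hC, τ, ⟨hτpos, hτ1⟩, fun k => hall k k.zero_le⟩

theorem sublinear_rate (h : LojasiewiczDescent u us r d a M θ k₀)
    (hθ : θ ∈ Ioo (1 / 2 : ℝ) 1) :
    ∃ C > (0 : ℝ), ∀ k : ℕ, 1 ≤ k →
      dist (u k) us ≤ C * (k : ℝ) ^ (-((1 - θ) / (2 * θ - 1))) := by
  obtain ⟨K, hK, hdist⟩ := h.exists_dist_le
  have ha := h.a_pos
  have hM := h.M_pos
  set p := 2 * θ - 1 with hp
  have hp01 : p ∈ Ioo (0 : ℝ) 1 := ⟨by linarith [hθ.1], by linarith [hθ.2]⟩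
  set Λ := M ^ 2 / a with hΛ
  have hΛpos : 0 < Λ := by positivity
  -- The bound 1 lets r^{1-θ} dominate √r; the bound Λ^{1/p} is the smallness needed by
  -- `rpow_recursion_step`.
  obtain ⟨N, hNk, hN⟩ := h.eventually_r_le (ε := min 1 (Λ ^ (1 / p)))
    (lt_min one_pos (Real.rpow_pos_of_pos hΛpos _))
  have hsmall : ∀ k ≥ N, r k ^ p ≤ Λ := by
    intro k hk
    have := Real.rpow_le_rpow (h.r_nonneg k) ((hN k hk).trans (min_le_right _ _)) hp01.1.le
    rwa [← Real.rpow_mul hΛpos.le, one_div_mul_cancel hp01.1.ne', Real.rpow_one] at this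
  set ν := p / (2 * Λ) with hν
  have hνpos : 0 < ν := div_pos hp01.1 (by positivity)
  -- Linear growth of r^{-p}, in a product form that survives r = 0.
  have hind : ∀ j : ℕ, (ν * j) * r (N + j) ^ p ≤ 1 := by
    intro j
    induction j with
    | zero => simp
    | succ j ih =>
      have h1 := h.rpow_le (lt_trans (by norm_num) hθ.1) (hNk.trans (Nat.le_add_right N j))
      rw [show 2 * θ = p + 1 by rw [hp]; ring] at h1
      have := rpow_recursion_step hp01 hΛpos (h.r_nonneg _)
        (hsmall (N + j + 1) (by omega)) h1 ih
      rw [← hν] at this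
      push_cast
      rw [mul_add, mul_one]
      exact this
  have hθ1 : 0 < 1 - θ := by linarith [hθ.2]
  set e := (1 - θ) / p with he
  have hepos : 0 < e := div_pos hθ1 hp01.1
  have hev : ∀ᶠ k : ℕ in atTop, dist (u k) us ≤ 2 * K * (2 / ν) ^ e * (k : ℝ) ^ (-e) := by
    -- Writing k = N + 1 + j, this forces k ≤ 2j, so the decay in j is a decay in k at the cost of a
    -- factor 2.
    filter_upwards [eventually_ge_atTop (2 * (N + 1))] with k hk
    obtain ⟨j, rfl⟩ := Nat.exists_eq_add_of_le (show N + 1 ≤ k by omega)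
    have hj : (N : ℝ) + 1 ≤ j := by exact_mod_cast (show N + 1 ≤ j by omega)
    have hle : N ≤ N + j := Nat.le_add_right _ _
    have h1 := hdist (N + j) (hNk.trans hle)
    have hkpos : (0 : ℝ) < ((N + 1 + j : ℕ) : ℝ) := by positivity
    have hrp : r (N + j) ^ p ≤ 2 / ν * ((N + 1 + j : ℕ) : ℝ)⁻¹ := by
      have hjpos : (0 : ℝ) < j := by linarith [(Nat.cast_nonneg N : (0 : ℝ) ≤ N)]
      have h2 : r (N + j) ^ p ≤ 1 / (ν * j) := by
        rw [le_div_iff₀ (by positivity)]; linarith [hind j]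
      refine h2.trans ?_
      rw [← div_eq_mul_inv, div_div, div_le_div_iff₀ (by positivity) (by positivity)]
      push_cast
      nlinarith
    have hre : r (N + j) ^ (1 - θ) ≤ (2 / ν) ^ e * ((N + 1 + j : ℕ) : ℝ) ^ (-e) := by
      have h3 : r (N + j) ^ (1 - θ) = (r (N + j) ^ p) ^ e := by
        rw [← Real.rpow_mul (h.r_nonneg _), he, mul_div_cancel₀ _ hp01.1.ne']
      rw [h3, Real.rpow_neg hkpos.le, ← Real.inv_rpow hkpos.le,
        ← Real.mul_rpow (by positivity) (by positivity)]
      exact Real.rpow_le_rpow (Real.rpow_nonneg (h.r_nonneg _) _) hrp hepos.le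
    have hexp : r (N + j) ^ (1 / 2 : ℝ) ≤ r (N + j) ^ (1 - θ) := by
      rcases (h.r_nonneg (N + j)).eq_or_lt with h0 | h0
      · rw [← h0, Real.zero_rpow hθ1.ne', Real.zero_rpow (by norm_num)]
      · exact Real.rpow_le_rpow_of_exponent_ge h0 ((hN _ hle).trans (min_le_left _ _))
          (by linarith [hθ.1])
    have h4 : dist (u (N + j + 1)) us ≤
        K * ((2 / ν) ^ e * ((N + 1 + j : ℕ) : ℝ) ^ (-e) +
          (2 / ν) ^ e * ((N + 1 + j : ℕ) : ℝ) ^ (-e)) :=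
      h1.trans (by gcongr; exact hexp.trans hre)
    rw [show u (N + 1 + j) = u (N + j + 1) by congr 1; ring]
    linarith
  exact exists_forall_le_mul_of_eventually (m := 1)
    (fun k hk => Real.rpow_pos_of_pos (by exact_mod_cast hk) _) hev

end LojasiewiczDescent

end Rates

end IRAPM

namespace IRAPM

/-! ### Fréchet subgradients and the KL inequality along sequences -/

section Subgradients

variable {V : Type*} [NormedAddCommGroup V] [InnerProductSpace ℝ V]

/-- After division by ‖z - x‖ the quadratic error is -C‖z - x‖, which vanishes in the limit. -/
theorem mem_frechetSubdiff_of_quadratic_minorant {f : V → EReal} {x w : V} {a C : ℝ}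
    (hfx : f x = a)
    (h : ∀ z, ((a + inner ℝ w (z - x) - C * ‖z - x‖ ^ 2 : ℝ) : EReal) ≤ f z) :
    w ∈ frechetSubdiff f x := by
  refine ⟨by simp [hfx], by simp [hfx], le_of_forall_lt_imp_le_of_dense fun e he => ?_⟩
  have hlim : Tendsto (fun z : V => ((-C * ‖z - x‖ : ℝ) : EReal)) (𝓝[≠] x) (𝓝 0) := by
    have h1 : Tendsto (fun z : V => -C * ‖z - x‖) (𝓝 x) (𝓝 (-C * ‖x - x‖)) :=
      (Continuous.tendsto (by fun_prop) x)
    rw [sub_self, norm_zero, mul_zero] at h1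
    exact (continuous_coe_real_ereal.tendsto 0).comp (h1.mono_left nhdsWithin_le_nhds)
  refine le_liminf_of_le (by isBoundedDefault) ?_
  filter_upwards [hlim.eventually_const_lt he, self_mem_nhdsWithin] with z hz hzx
  refine hz.le.trans ?_
  have hpos : 0 < ‖z - x‖ := norm_pos_iff.2 (sub_ne_zero.2 hzx)
  have hb := h z
  rw [hfx]
  induction hfz : f z with
  | bot => rw [hfz] at hb; exact absurd hb (EReal.bot_lt_coe _).not_ge
  | top =>
    rw [EReal.top_sub_coe, EReal.top_sub_coe,
      EReal.top_div_of_pos_ne_top (by exact_mod_cast hpos) (EReal.coe_ne_top _)]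
    exact le_top
  | coe b =>
    rw [hfz, EReal.coe_le_coe_iff] at hb
    rw [← EReal.coe_sub, ← EReal.coe_sub, ← EReal.coe_div, EReal.coe_le_coe_iff,
      le_div_iff₀ hpos]
    linarith

theorem frechetSubdiff_subset_limitingSubdiff (f : V → EReal) (x : V) :
    frechetSubdiff f x ⊆ limitingSubdiff f x := fun w hw =>
  ⟨hw.1, hw.2.1, fun _ => x, fun _ => w, tendsto_const_nhds, tendsto_const_nhds, fun _ => hw,
    tendsto_const_nhds⟩

theorem lazySlope_le_of_mem_frechetSubdiff {f : V → EReal} {x w : V}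
    (hw : w ∈ frechetSubdiff f x) : lazySlope f x ≤ ‖w‖ₑ :=
  iInf₂_le w (frechetSubdiff_subset_limitingSubdiff f x hw)

/-- The Kurdyka–Łojasiewicz inequality for a power function, along a sequence with subgradients. -/
theorem HasKLPropertyWith.eventually_rpow_le {f : V → EReal} {x : V} {c θ : ℝ} (hc : 0 < c)
    (hθ : θ ∈ Ico (0 : ℝ) 1) (h : HasKLPropertyWith f x (fun t : ℝ => c * t ^ (1 - θ)))
    {z w : ℕ → V} {a : ℝ} {t : ℕ → ℝ} (hfx : f x = a) (hz : Tendsto z atTop (𝓝 x))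
    (hfz : ∀ k, f (z k) = ((a + t k : ℝ) : EReal)) (ht : Tendsto t atTop (𝓝 0))
    (hw : ∀ k, w k ∈ frechetSubdiff f (z k)) :
    ∀ᶠ k in atTop, 0 < t k → t k ^ θ ≤ c * (1 - θ) * ‖w k‖ := by
  obtain ⟨-, υ, hυ, -, U, hU, hKL⟩ := h
  -- Convergence of z gives nothing here, since f need not be continuous; the values are controlled
  -- through t.
  have hsmall : ∀ᶠ k in atTop, ((t k : ℝ) : EReal) < υ :=
    ((continuous_coe_real_ereal.tendsto 0).comp ht).eventually_lt_const hυ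
  filter_upwards [hz hU, hsmall] with k hkU hk htk
  have h1 : f x < f (z k) := by
    rw [hfx, hfz, EReal.coe_lt_coe_iff]; linarith
  have h2 : f (z k) < f x + υ := by
    rw [hfx, hfz, EReal.coe_add]
    exact EReal.add_lt_add_left_coe hk a
  have h3 := hKL (z k) hkU h1 h2
  have h4 : (f (z k) - f x).toReal = t k := by
    rw [hfx, hfz, ← EReal.coe_sub, EReal.toReal_coe]; ring
  have hder : deriv (fun t : ℝ => c * t ^ (1 - θ)) (t k) = c * ((1 - θ) * t k ^ (-θ)) := by
    rw [deriv_const_mul _ (Real.differentiableAt_rpow_const_of_ne _ htk.ne'),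
      Real.deriv_rpow_const]
    congr 3; ring
  have hθ' : 0 < 1 - θ := by linarith [hθ.2]
  have hpos : 0 < t k ^ θ := Real.rpow_pos_of_pos htk _
  rw [h4, hder] at h3
  have h5 := h3.trans (mul_le_mul_right (lazySlope_le_of_mem_frechetSubdiff (hw k)) _)
  rw [← ofReal_norm, ← ENNReal.ofReal_mul (by positivity), ENNReal.one_le_ofReal,
    Real.rpow_neg htk.le] at h5
  have h6 : c * ((1 - θ) * (t k ^ θ)⁻¹) * ‖w k‖ = c * (1 - θ) * ‖w k‖ / t k ^ θ := by
    field_simp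
  rwa [h6, le_div_iff₀ hpos, one_mul] at h5

end Subgradients

/-! ### Values of the merit function and regularized projections -/

section Values

theorem indicatorFn_of_mem {X : Type*} {A : Set X} {x : X} (h : x ∈ A) : indicatorFn A x = 0 := by
  simp [indicatorFn, h]

theorem indicatorFn_of_notMem {X : Type*} {A : Set X} {x : X} (h : x ∉ A) :
    indicatorFn A x = ⊤ := by
  simp [indicatorFn, h]

variable {n : ℕ} {A B : Set (EuclideanSpace ℝ (Fin n))}

theorem objective_of_mem {x y : EuclideanSpace ℝ (Fin n)} (hx : x ∈ A) (hy : y ∈ B) :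
    objective A B x y = ((1 / 2 * ‖x - y‖ ^ 2 : ℝ) : EReal) := by
  simp [objective, indicatorFn_of_mem hx, indicatorFn_of_mem hy]

theorem objective_eq_top {x y : EuclideanSpace ℝ (Fin n)} (h : ¬(x ∈ A ∧ y ∈ B)) :
    objective A B x y = ⊤ := by
  by_cases hx : x ∈ A
  · have hy : y ∉ B := fun hy => h ⟨hx, hy⟩
    rw [objective, indicatorFn_of_mem hx, indicatorFn_of_notMem hy, add_zero, EReal.coe_add_top]
  · rw [objective, indicatorFn_of_notMem hx, EReal.coe_add_top]
    by_cases hy : y ∈ B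
    · simp [indicatorFn_of_mem hy]
    · simp [indicatorFn_of_notMem hy]

theorem merit_of_mem {z : Triple n} (hx : z.fst.fst ∈ A) (hy : z.fst.snd ∈ B) :
    merit A B z =
      ((1 / 2 * ‖z.fst.fst - z.fst.snd‖ ^ 2 + 1 / 2 * z.snd ^ 2 : ℝ) : EReal) := by
  rw [merit, objective_of_mem hx hy, EReal.coe_add]

theorem merit_eq_top {z : Triple n} (h : ¬(z.fst.fst ∈ A ∧ z.fst.snd ∈ B)) :
    merit A B z = ⊤ := by
  rw [merit, objective_eq_top h, EReal.top_add_coe]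

theorem Qfun_of_mem {μ : ℝ} {x y v : EuclideanSpace ℝ (Fin n)} (hx : x ∈ A) (hy : y ∈ B)
    (hv : v ∈ B) :
    Qfun A B μ x y v =
      ((1 / (2 * μ) * ‖v - y‖ ^ 2 + 1 / 2 * ‖x - v‖ ^ 2 - 1 / 2 * ‖x - y‖ ^ 2 : ℝ) : EReal) := by
  rw [Qfun, objective_of_mem hx hv, objective_of_mem hx hy, EReal.coe_sub, EReal.coe_add]

theorem norm_sq_triple (z : Triple n) :
    ‖z‖ ^ 2 = ‖z.fst.fst‖ ^ 2 + ‖z.fst.snd‖ ^ 2 + z.snd ^ 2 := by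
  rw [WithLp.prod_norm_sq_eq_of_L2, WithLp.prod_norm_sq_eq_of_L2, Real.norm_eq_abs, sq_abs]

theorem inner_triple (z w : Triple n) :
    inner ℝ z w =
      inner ℝ z.fst.fst w.fst.fst + inner ℝ z.fst.snd w.fst.snd + z.snd * w.snd := by
  rw [WithLp.prod_inner_apply, WithLp.prod_inner_apply]
  simp [mul_comm]

theorem half_norm_sub_sq_expand {E : Type*} [NormedAddCommGroup E] [InnerProductSpace ℝ E]
    (v u p : E) :
    1 / 2 * ‖v - p‖ ^ 2 =
      1 / 2 * ‖u - p‖ ^ 2 + inner ℝ (u - p) (v - u) + 1 / 2 * ‖v - u‖ ^ 2 := by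
  have := norm_add_sq_real (u - p) (v - u)
  rw [show u - p + (v - u) = v - p by abel] at this
  linarith

/-- Completing the square. The last term does not involve v, so projecting the regularized point is
the same as minimizing the proximally regularized objective. -/
theorem norm_sub_regPoint_sq {μ : ℝ} (hμ : 0 < μ) (v y x : EuclideanSpace ℝ (Fin n)) :
    (1 + 1 / μ) * (1 / 2 * ‖v - regPoint μ y x‖ ^ 2) =
      1 / 2 * ‖v - x‖ ^ 2 + 1 / (2 * μ) * ‖v - y‖ ^ 2 - 1 / (2 * (μ + 1)) * ‖x - y‖ ^ 2 := by
  have h1 : v - regPoint μ y x = (1 / (μ + 1)) • (v - y) + (μ / (μ + 1)) • (v - x) := by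
    have : v = (1 / (μ + 1) + μ / (μ + 1)) • v := by
      rw [← add_div, add_comm 1 μ, div_self (by positivity), one_smul]
    conv_lhs => rw [this]
    rw [regPoint]
    module
  have h2 := norm_add_sq_real ((1 / (μ + 1)) • (v - y)) ((μ / (μ + 1)) • (v - x))
  rw [norm_smul, norm_smul, real_inner_smul_left, real_inner_smul_right, mul_pow, mul_pow,
    Real.norm_eq_abs, Real.norm_eq_abs, sq_abs, sq_abs] at h2
  have h3 := norm_sub_sq_real (v - y) (v - x)
  rw [show v - y - (v - x) = x - y by abel] at h3
  rw [h1, h2, h3]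
  field_simp
  ring

/-- A projection of the regularized point minimizes the regularized objective. -/
theorem le_of_mem_proj_regPoint {S : Set (EuclideanSpace ℝ (Fin n))} {μ : ℝ} (hμ : 0 < μ)
    {u v y x : EuclideanSpace ℝ (Fin n)} (hu : u ∈ proj S (regPoint μ y x)) (hv : v ∈ S) :
    1 / 2 * ‖u - x‖ ^ 2 + 1 / (2 * μ) * ‖u - y‖ ^ 2 ≤
      1 / 2 * ‖v - x‖ ^ 2 + 1 / (2 * μ) * ‖v - y‖ ^ 2 := by
  have h : 1 / 2 * ‖u - regPoint μ y x‖ ^ 2 ≤ 1 / 2 * ‖v - regPoint μ y x‖ ^ 2 := hu.2 hv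
  have h2 := mul_le_mul_of_nonneg_left h (by positivity : (0 : ℝ) ≤ 1 + 1 / μ)
  rw [norm_sub_regPoint_sq hμ, norm_sub_regPoint_sq hμ] at h2
  linarith

/-- First-order optimality without convexity: expanding the minimized objective about u leaves a
purely quadratic error, of the kind a Fréchet subgradient tolerates. -/
theorem inner_ge_of_mem_proj_regPoint {S : Set (EuclideanSpace ℝ (Fin n))} {μ : ℝ} (hμ : 0 < μ)
    {u v y x : EuclideanSpace ℝ (Fin n)} (hu : u ∈ proj S (regPoint μ y x)) (hv : v ∈ S) :
    -((1 + 1 / μ) / 2 * ‖v - u‖ ^ 2) ≤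
      inner ℝ (u - x) (v - u) + 1 / μ * inner ℝ (u - y) (v - u) := by
  have h := le_of_mem_proj_regPoint hμ hu hv
  have h1 := half_norm_sub_sq_expand v u x
  have h2 : 1 / (2 * μ) * ‖v - y‖ ^ 2 =
      1 / μ * (1 / 2 * ‖u - y‖ ^ 2 + inner ℝ (u - y) (v - u) + 1 / 2 * ‖v - u‖ ^ 2) := by
    rw [← half_norm_sub_sq_expand v u y]; field_simp
  rw [h1, h2] at h
  have h3 : 1 / (2 * μ) * ‖u - y‖ ^ 2 = 1 / μ * (1 / 2 * ‖u - y‖ ^ 2) := by field_simp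
  rw [h3] at h
  linarith

/-- A Fréchet subgradient of the merit function at a pair of projected regularized points. -/
theorem mem_frechetSubdiff_merit {lam mu : ℝ} (hlam : 0 < lam) (hmu : 0 < mu)
    {x y xk yk : EuclideanSpace ℝ (Fin n)} (hx : x ∈ proj A (regPoint lam xk yk))
    (hy : y ∈ proj B (regPoint mu yk x)) (ρ : ℝ) :
    mkTriple (yk - y - (1 / lam) • (x - xk)) (-((1 / mu) • (y - yk))) ρ ∈
      frechetSubdiff (merit A B) (mkTriple x y ρ) := by
  have hval : merit A B (mkTriple x y ρ) =
      ((1 / 2 * ‖x - y‖ ^ 2 + 1 / 2 * ρ ^ 2 : ℝ) : EReal) :=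
    merit_of_mem (z := mkTriple x y ρ) hx.1 hy.1
  refine mem_frechetSubdiff_of_quadratic_minorant (C := (1 + 1 / lam) / 2 + (1 + 1 / mu) / 2)
    hval fun z => ?_
  by_cases hz : z.fst.fst ∈ A ∧ z.fst.snd ∈ B
  swap
  · rw [merit_eq_top hz]; exact le_top
  rw [merit_of_mem hz.1 hz.2, EReal.coe_le_coe_iff, inner_triple, norm_sq_triple]
  show 1 / 2 * ‖x - y‖ ^ 2 + 1 / 2 * ρ ^ 2 +
    (inner ℝ (yk - y - (1 / lam) • (x - xk)) (z.fst.fst - x) +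
      inner ℝ (-((1 / mu) • (y - yk))) (z.fst.snd - y) + ρ * (z.snd - ρ)) -
    ((1 + 1 / lam) / 2 + (1 + 1 / mu) / 2) *
      (‖z.fst.fst - x‖ ^ 2 + ‖z.fst.snd - y‖ ^ 2 + (z.snd - ρ) ^ 2) ≤ _
  have h1 := inner_ge_of_mem_proj_regPoint hlam hx hz.1
  have h2 := inner_ge_of_mem_proj_regPoint hmu hy hz.2
  generalize z.fst.fst = X at *
  generalize z.fst.snd = Y at *
  generalize z.snd = R at *
  -- The x-step was taken against yk but the coupling gradient at (x, y) is x - y; the mismatch is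
  -- yk - y. The y-step already uses x, so in `e2` nothing similar remains.
  have e1 : inner ℝ (yk - y - (1 / lam) • (x - xk)) (X - x) =
      inner ℝ (x - y) (X - x) - (inner ℝ (x - yk) (X - x) + 1 / lam * inner ℝ (x - xk) (X - x)) := by
    rw [← real_inner_smul_left, ← inner_add_left, ← inner_sub_left]
    congr 1; abel
  have e2 : inner ℝ (-((1 / mu) • (y - yk))) (Y - y) =
      inner ℝ (y - x) (Y - y) - (inner ℝ (y - x) (Y - y) + 1 / mu * inner ℝ (y - yk) (Y - y)) := by
    rw [inner_neg_left, real_inner_smul_left]; ring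
  have e3 : ‖X - Y‖ ^ 2 = ‖x - y‖ ^ 2 + 2 * (inner ℝ (x - y) (X - x) + inner ℝ (y - x) (Y - y)) +
      ‖(X - x) - (Y - y)‖ ^ 2 := by
    have h := norm_add_sq_real (x - y) ((X - x) - (Y - y))
    rw [show x - y + (X - x - (Y - y)) = X - Y by abel, inner_sub_right] at h
    rw [h, ← neg_sub x y, inner_neg_left]; ring
  rw [e1, e2, e3]
  have p1 : 0 < 1 / lam := by positivity
  have p2 : 0 < 1 / mu := by positivity
  have s0 := sq_nonneg ‖X - x - (Y - y)‖
  have s1 := mul_nonneg p2.le (sq_nonneg ‖X - x‖)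
  have s2 := mul_nonneg p1.le (sq_nonneg ‖Y - y‖)
  have s3 := mul_nonneg p1.le (sq_nonneg (R - ρ))
  have s4 := mul_nonneg p2.le (sq_nonneg (R - ρ))
  nlinarith [sq_nonneg ‖X - x‖, sq_nonneg ‖Y - y‖, sq_nonneg (R - ρ)]

end Values

/-! ### Estimates for one iteration -/

section Step

variable {n : ℕ}

theorem norm_sub_sq_le_two_mul {E : Type*} [NormedAddCommGroup E] [InnerProductSpace ℝ E]
    (u v : E) : ‖u - v‖ ^ 2 ≤ 2 * ‖u‖ ^ 2 + 2 * ‖v‖ ^ 2 := by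
  have := norm_sub_sq_real u v
  have := norm_add_sq_real u v
  nlinarith [sq_nonneg ‖u + v‖]

/-- What one iteration provides: sufficient decrease with decrement `D`, and a nearby point of
comparable merit with a subgradient controlled by `D`. -/
theorem iteration_estimates {A B : Set (EuclideanSpace ℝ (Fin n))} {lam mu ζ a b s : ℝ}
    {xk yk xn yn yh : EuclideanSpace ℝ (Fin n)} (hlam : 0 < lam) (hmu : 0 < mu) (hζ : 0 < ζ)
    (hs : 1 / ζ = s) (ha : a ≤ 1)
    (halam : a ≤ 1 / (2 * lam)) (hamu : a ≤ 1 / (2 * mu)) (hblam : 1 / lam ≤ b)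
    (hbmu : 1 / mu ≤ b) (hxk : xk ∈ A) (hyk : yk ∈ B) (hxn : xn ∈ proj A (regPoint lam xk yk))
    (hyn : yn ∈ B) (hyh : yh ∈ proj B (regPoint mu yk xn))
    (hQ : Qfun A B mu xn yk yn ≤ (ζ : EReal) * Qfun A B mu xn yk yh)
    (hdist : ‖yn - yh‖ ≤ √(-((1 - ζ) / ζ * (Qfun A B mu xn yk yn).toReal))) :
    ∃ D : ℝ, ‖xn - xk‖ ^ 2 + ‖yn - yk‖ ^ 2 ≤ D ∧
      1 / 2 * ‖xn - yn‖ ^ 2 + a * D ≤ 1 / 2 * ‖xk - yk‖ ^ 2 ∧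
      ∃ (z w : Triple n) (e : ℝ), w ∈ frechetSubdiff (merit A B) z ∧
        merit A B z = ((1 / 2 * ‖xn - yn‖ ^ 2 + e : ℝ) : EReal) ∧ 0 ≤ e ∧ e ≤ b * D ∧
        ‖w‖ ^ 2 ≤ (4 * (1 + s) + 2 * b ^ 2 + 2 * (1 + s) * b ^ 2 + 2 * s + 2 * (1 + s) * b) * D ∧
        ‖z - mkTriple xn yn 0‖ ^ 2 ≤ (3 * s + 2 * (1 + s) * b) * D := by
  rw [Qfun_of_mem hxn.1 hyk hyn] at hQ hdist
  rw [Qfun_of_mem hxn.1 hyk hyh.1, ← EReal.coe_mul, EReal.coe_le_coe_iff] at hQ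
  rw [EReal.toReal_coe] at hdist
  set Qn := 1 / (2 * mu) * ‖yn - yk‖ ^ 2 + 1 / 2 * ‖xn - yn‖ ^ 2 - 1 / 2 * ‖xn - yk‖ ^ 2 with hQn
  set Qh := 1 / (2 * mu) * ‖yh - yk‖ ^ 2 + 1 / 2 * ‖xn - yh‖ ^ 2 - 1 / 2 * ‖xn - yk‖ ^ 2 with hQh
  have hspos : 0 < s := by rw [← hs]; positivity
  have hsζ : s * ζ = 1 := by rw [← hs]; field_simp
  have hmu2 : 1 / (2 * mu) = 1 / mu / 2 := by field_simp
  have hlam2 : 1 / (2 * lam) = 1 / lam / 2 := by field_simp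
  have pmu : 0 < 1 / mu := by positivity
  have plam : 0 < 1 / lam := by positivity
  have hb : 0 < b := plam.trans_le hblam
  have hx1 := le_of_mem_proj_regPoint hlam hxn hxk
  rw [sub_self, norm_zero] at hx1
  have hQh0 : Qh ≤ 0 := by
    have := le_of_mem_proj_regPoint hmu hyh hyk
    rw [sub_self, norm_zero, norm_sub_rev yh xn, norm_sub_rev yk xn] at this
    linarith
  have hQhn : Qh ≤ Qn := by
    have := le_of_mem_proj_regPoint hmu hyh hyn
    rw [norm_sub_rev yh xn, norm_sub_rev yn xn] at this
    linarith
  have hQn0 : Qn ≤ 0 := hQ.trans (mul_nonpos_of_nonneg_of_nonpos hζ.le hQh0)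
  have hQhs : -Qh ≤ s * -Qn := by
    have := mul_le_mul_of_nonneg_left hQ hspos.le
    rw [← mul_assoc, hsζ, one_mul] at this
    linarith
  have hd2 : ‖yn - yh‖ ^ 2 ≤ s * -Qn := by
    have h0 : 0 ≤ -((1 - ζ) / ζ * Qn) ∨ -((1 - ζ) / ζ * Qn) < 0 := le_or_gt _ _
    have h1 : -((1 - ζ) / ζ * Qn) = s * -Qn + Qn := by rw [← hs]; field_simp; ring
    rcases h0 with h0 | h0
    -- A negative radicand makes `√` zero, so the other case has yn = yh.
    · have := (Real.le_sqrt (norm_nonneg _) h0).1 hdist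
      linarith
    · rw [Real.sqrt_eq_zero_of_nonpos h0.le] at hdist
      have : ‖yn - yh‖ = 0 := le_antisymm hdist (norm_nonneg _)
      rw [this]; nlinarith
  have hyy : ‖yh - yk‖ ^ 2 ≤ 2 * ‖yn - yk‖ ^ 2 + 2 * (s * -Qn) := by
    have := norm_sub_sq_le_two_mul (yn - yk) (yn - yh)
    rw [show yn - yk - (yn - yh) = yh - yk by abel] at this
    linarith
  -- The term -Qn controls ‖yn - yh‖² and -Qh, which the step lengths do not.
  set D := ‖xn - xk‖ ^ 2 + ‖yn - yk‖ ^ 2 + -Qn with hD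
  have n1 := sq_nonneg ‖xn - xk‖
  have n2 := sq_nonneg ‖yn - yk‖
  clear_value Qn Qh D
  have hDy : ‖yn - yk‖ ^ 2 ≤ D := by linarith
  have hDx : ‖xn - xk‖ ^ 2 ≤ D := by linarith
  have hDq : -Qn ≤ D := by linarith
  have hD0 : 0 ≤ D := n1.trans hDx
  have hyD : ‖yh - yk‖ ^ 2 ≤ 2 * (1 + s) * D := by
    have := mul_le_mul_of_nonneg_left hDq hspos.le
    linarith
  -- The exact gap L(xn, yn) - L(xn, yh) may be negative. Adding ‖yn - yk‖² / (2μ) to it gives ρ² /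
  -- 2, which is nonnegative because Qh ≤ Qn; the added term is the e of the conclusion.
  obtain ⟨ρ, hρ2⟩ : ∃ ρ : ℝ, ρ ^ 2 = 2 * (-Qh + Qn + 1 / (2 * mu) * ‖yh - yk‖ ^ 2) := by
    refine ⟨_, Real.sq_sqrt ?_⟩
    have : 0 ≤ 1 / (2 * mu) * ‖yh - yk‖ ^ 2 := by positivity
    linarith
  have hρD : ρ ^ 2 ≤ (2 * s + 2 * (1 + s) * b) * D := by
    have h1 := mul_le_mul_of_nonneg_left hDq hspos.le
    have h2 := mul_le_mul hbmu hyD (sq_nonneg _) hb.le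
    rw [hρ2, hmu2]
    linarith
  refine ⟨D, by linarith, ?_, mkTriple xn yh ρ, _, 1 / (2 * mu) * ‖yn - yk‖ ^ 2,
    mem_frechetSubdiff_merit hlam hmu hxn hyh ρ, ?_, by positivity, ?_, ?_, ?_⟩
  · have h1 := mul_le_mul_of_nonneg_right halam n1
    have h2 := mul_le_mul_of_nonneg_right hamu n2
    have h3 := mul_le_mul_of_nonneg_right ha (neg_nonneg.2 hQn0)
    rw [hD, mul_add, mul_add]
    linarith
  · rw [merit_of_mem (z := mkTriple xn yh ρ) hxn.1 hyh.1, EReal.coe_eq_coe_iff]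
    show 1 / 2 * ‖xn - yh‖ ^ 2 + 1 / 2 * ρ ^ 2 = _
    rw [hρ2]; linarith
  · have := mul_le_mul hbmu hDy n2 hb.le
    rw [hmu2]
    linarith [mul_nonneg pmu.le n2]
  · rw [norm_sq_triple]
    show ‖yk - yh - (1 / lam) • (xn - xk)‖ ^ 2 + ‖-((1 / mu) • (yh - yk))‖ ^ 2 + ρ ^ 2 ≤ _
    have h1 := norm_sub_sq_le_two_mul (yk - yh) ((1 / lam) • (xn - xk))
    rw [norm_smul, mul_pow, Real.norm_eq_abs, sq_abs, norm_sub_rev yk yh] at h1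
    rw [norm_neg, norm_smul, mul_pow, Real.norm_eq_abs, sq_abs]
    have h2 := mul_le_mul (pow_le_pow_left₀ plam.le hblam 2) hDx n1 (sq_nonneg b)
    have h3 := mul_le_mul (pow_le_pow_left₀ pmu.le hbmu 2) hyD (sq_nonneg _) (sq_nonneg b)
    linarith
  · rw [norm_sq_triple]
    show ‖xn - xn‖ ^ 2 + ‖yh - yn‖ ^ 2 + (ρ - 0) ^ 2 ≤ _
    rw [sub_self, norm_zero, norm_sub_rev yh yn, sub_zero]
    have := mul_le_mul_of_nonneg_left hDq hspos.le
    linarith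

end Step

end IRAPM

/-! ### From the algorithm to the abstract descent, and the theorem -/

namespace IRAPM

theorem IsGenerated.exists_lojasiewiczDescent {n : ℕ} {A B : Set (EuclideanSpace ℝ (Fin n))}
    {lam mu : ℕ → ℝ} {ζ : ℝ} {x y : ℕ → EuclideanSpace ℝ (Fin n)}
    (hxy : IsGenerated A B lam mu ζ x y) {xs ys : EuclideanSpace ℝ (Fin n)} (hxs : xs ∈ A)
    (hys : ys ∈ B) (hlim : Tendsto (fun k => mkPair (x k) (y k)) atTop (𝓝 (mkPair xs ys)))
    {c θ : ℝ} (hc : 0 < c) (hθ : θ ∈ Ico (0 : ℝ) 1)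
    (hKL : HasKLPropertyWith (merit A B) (mkTriple xs ys 0) (fun t : ℝ => c * t ^ (1 - θ))) :
    ∃ (r d : ℕ → ℝ) (a M : ℝ) (k₀ : ℕ),
      LojasiewiczDescent (fun k => mkPair (x k) (y k)) (mkPair xs ys) r d a M θ k₀ := by
  obtain ⟨lo₁, hi₁, hlo₁, hlohi₁, hlam⟩ := hxy.lam_bounds
  obtain ⟨lo₂, hi₂, hlo₂, hlohi₂, hmu⟩ := hxy.mu_bounds
  have hhi₁ := hlo₁.trans hlohi₁
  have hhi₂ := hlo₂.trans hlohi₂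
  have hζ := hxy.zeta_mem.1
  have hxA : ∀ k, x k ∈ A
    | 0 => hxy.x_zero
    | k + 1 => (hxy.step_x k).1
  have hyB : ∀ k, y k ∈ B
    | 0 => hxy.y_zero
    | k + 1 => (hxy.step_y k).1
  -- Uniform constants: a uses the upper parameter bounds, b the lower ones.
  obtain ⟨a, ha, ha1, ha₁, ha₂⟩ : ∃ a : ℝ, 0 < a ∧ a ≤ 1 ∧ a ≤ 1 / (2 * hi₁) ∧
      a ≤ 1 / (2 * hi₂) :=
    ⟨min 1 (min (1 / (2 * hi₁)) (1 / (2 * hi₂))), by positivity, min_le_left _ _,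
      (min_le_right _ _).trans (min_le_left _ _), (min_le_right _ _).trans (min_le_right _ _)⟩
  obtain ⟨b, hb₁, hb₂⟩ : ∃ b : ℝ, 1 / lo₁ ≤ b ∧ 1 / lo₂ ≤ b :=
    ⟨_, le_max_left _ _, le_max_right _ _⟩
  obtain ⟨s, hs⟩ : ∃ s, 1 / ζ = s := ⟨_, rfl⟩
  have hbpos : 0 < b := (one_div_pos.2 hlo₁).trans_le hb₁
  have hspos : 0 < s := hs ▸ one_div_pos.2 hζ
  choose hyn yh hyh hQ hdist using hxy.step_y
  have hiter := fun k =>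
    iteration_estimates (a := a) (b := b) (hlo₁.trans_le (hlam k).1) (hlo₂.trans_le (hmu k).1)
      hζ hs ha1
      (ha₁.trans (one_div_le_one_div_of_le (by linarith [(hlam k).1]) (by linarith [(hlam k).2])))
      (ha₂.trans (one_div_le_one_div_of_le (by linarith [(hmu k).1]) (by linarith [(hmu k).2])))
      ((one_div_le_one_div_of_le hlo₁ (hlam k).1).trans hb₁)
      ((one_div_le_one_div_of_le hlo₂ (hmu k).1).trans hb₂)
      (hxA k) (hyB k) (hxy.step_x k) (hyn k) (hyh k) (hQ k) (hdist k)
  choose D hD hdesc z w e hw hmerit he0 heD hwD hzD using hiter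
  obtain ⟨Cw, hCw⟩ : ∃ C, C = 4 * (1 + s) + 2 * b ^ 2 + 2 * (1 + s) * b ^ 2 + 2 * s +
    2 * (1 + s) * b := ⟨_, rfl⟩
  obtain ⟨Cz, hCz⟩ : ∃ C, C = 3 * s + 2 * (1 + s) * b := ⟨_, rfl⟩
  have hCwpos : 0 < Cw := by rw [hCw]; positivity
  simp only [← hCw] at hwD
  simp only [← hCz] at hzD
  have hD0 : ∀ k, 0 ≤ D k := fun k => le_trans (by positivity) (hD k)
  have hx : Tendsto x atTop (𝓝 xs) :=
    ((WithLp.continuous_fst 2 _ _).tendsto (mkPair xs ys)).comp hlim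
  have hy : Tendsto y atTop (𝓝 ys) :=
    ((WithLp.continuous_snd 2 _ _).tendsto (mkPair xs ys)).comp hlim
  obtain ⟨r, hr⟩ : ∃ r : ℕ → ℝ, ∀ k, r k = 1 / 2 * ‖x k - y k‖ ^ 2 - 1 / 2 * ‖xs - ys‖ ^ 2 :=
    ⟨_, fun _ => rfl⟩
  have hrlim : Tendsto r atTop (𝓝 0) := by
    have := (((hx.sub hy).norm.pow 2).const_mul (1 / 2 : ℝ)).sub_const (1 / 2 * ‖xs - ys‖ ^ 2)
    rw [sub_self] at this
    exact this.congr fun k => (hr k).symm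
  have hrdesc : ∀ k, r (k + 1) + a * D k ≤ r k := fun k => by
    rw [hr, hr]; linarith [hdesc k]
  have hanti : Antitone r := antitone_nat_of_succ_le fun k => by
    linarith [hrdesc k, mul_nonneg ha.le (hD0 k)]
  have hr0 : ∀ k, 0 ≤ r k := fun k => hanti.le_of_tendsto hrlim k
  have hDlim : Tendsto D atTop (𝓝 0) := by
    refine squeeze_zero hD0 (fun k => ?_) (by simpa using hrlim.div_const a)
    rw [le_div_iff₀ ha]
    linarith [hrdesc k, hr0 (k + 1)]
  have hrlim' := hrlim.comp (tendsto_add_atTop_nat 1)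
  have helim : Tendsto e atTop (𝓝 0) :=
    squeeze_zero he0 heD (by simpa using hDlim.const_mul b)
  have hzlim : Tendsto z atTop (𝓝 (mkTriple xs ys 0)) := by
    have h1 : Tendsto (fun k => mkTriple (x (k + 1)) (y (k + 1)) 0) atTop
        (𝓝 (mkTriple xs ys 0)) := by
      have h2 : Continuous fun p : Pair n => (WithLp.toLp 2 (p, (0 : ℝ)) : Triple n) :=
        (WithLp.prod_continuous_toLp 2 _ _).comp (by fun_prop)
      exact (h2.tendsto _).comp (hlim.comp (tendsto_add_atTop_nat 1))
    have h3 : Tendsto (fun k => z k - mkTriple (x (k + 1)) (y (k + 1)) 0) atTop (𝓝 0) := by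
      rw [tendsto_zero_iff_norm_tendsto_zero]
      refine squeeze_zero (fun _ => norm_nonneg _) (fun k => Real.le_sqrt_of_sq_le (hzD k)) ?_
      simpa using (hDlim.const_mul Cz).sqrt
    simpa using h3.add h1
  have hfx : merit A B (mkTriple xs ys 0) = ((1 / 2 * ‖xs - ys‖ ^ 2 : ℝ) : EReal) := by
    rw [merit_of_mem (z := mkTriple xs ys 0) hxs hys]
    simp [mkTriple, mkPair]
  have hkl := hKL.eventually_rpow_le hc hθ hfx hzlim (t := fun k => r (k + 1) + e k)
    (fun k => by rw [hmerit, hr]; congr 1; ring) (by simpa using hrlim'.add helim) hw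
  obtain ⟨k₀, hk₀⟩ := eventually_atTop.1 hkl
  have hθ1 : 0 < 1 - θ := by linarith [hθ.2]
  refine ⟨r, fun k => √(D k), a, c * (1 - θ) * √Cw, k₀, hlim, fun k => ?_, hr0,
    fun k => Real.sqrt_nonneg _, ha, by positivity, fun k => ?_, hrlim, hθ, fun k hk hpos => ?_⟩
  · refine Real.le_sqrt_of_sq_le ?_
    rw [dist_eq_norm, norm_sub_rev, WithLp.prod_norm_sq_eq_of_L2]
    exact hD k
  · rw [Real.sq_sqrt (hD0 k)]; exact hrdesc k
  -- The KL inequality holds at the auxiliary point, whose excess is r_{k+1} + e_k; since e_k ≥ 0,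
  -- it passes to r_{k+1} by monotonicity.
  · have hle : r (k + 1) ≤ r (k + 1) + e k := le_add_of_nonneg_right (he0 k)
    calc r (k + 1) ^ θ ≤ (r (k + 1) + e k) ^ θ := Real.rpow_le_rpow hpos.le hle hθ.1
      _ ≤ c * (1 - θ) * ‖w k‖ := hk₀ k hk (hpos.trans_le hle)
      _ ≤ c * (1 - θ) * √(Cw * D k) := by gcongr; exact Real.le_sqrt_of_sq_le (hwD k)
      _ = c * (1 - θ) * √Cw * √(D k) := by rw [Real.sqrt_mul hCwpos.le, ← mul_assoc]

end IRAPM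

theorem mainTheorem2 {n : ℕ} (A B : Set (EuclideanSpace ℝ (Fin n)))
    (hA : IsClosed A) (hB : IsClosed B)
    (lam mu : ℕ → ℝ) (ζ : ℝ) (x y : ℕ → EuclideanSpace ℝ (Fin n))
    (hxy : IRAPM.IsGenerated A B lam mu ζ x y)
    (xs ys : EuclideanSpace ℝ (Fin n)) (hxs : xs ∈ A) (hys : ys ∈ B)
    (hlim : Tendsto (fun k => IRAPM.mkPair (x k) (y k)) atTop (𝓝 (IRAPM.mkPair xs ys)))
    (c θ : ℝ) (hc : 0 < c) (hθ : θ ∈ Ico (0 : ℝ) 1)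
    (hKL : IRAPM.HasKLPropertyWith (IRAPM.merit A B) (IRAPM.mkTriple xs ys 0)
      (fun t : ℝ => c * t ^ (1 - θ))) :
    (θ = 0 → ∃ N : ℕ, ∀ k ≥ N, x k = xs ∧ y k = ys) ∧
    (θ ∈ Ioc (0 : ℝ) (1 / 2) → ∃ C > (0 : ℝ), ∃ τ ∈ Ioo (0 : ℝ) 1, ∀ k : ℕ,
      ‖IRAPM.mkPair (x k) (y k) - IRAPM.mkPair xs ys‖ ≤ C * τ ^ k) ∧
    (θ ∈ Ioo (1 / 2 : ℝ) 1 → ∃ C > (0 : ℝ), ∀ k : ℕ, 1 ≤ k →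
      ‖IRAPM.mkPair (x k) (y k) - IRAPM.mkPair xs ys‖ ≤
        C * (k : ℝ) ^ (-((1 - θ) / (2 * θ - 1)))) := by
  obtain ⟨r, d, a, M, k₀, h⟩ := hxy.exists_lojasiewiczDescent hxs hys hlim hc hθ hKL
  simp only [← dist_eq_norm]
  refine ⟨fun h0 => ?_, h.linear_rate, h.sublinear_rate⟩
  obtain ⟨N, hN⟩ := h.finite_termination h0
  exact ⟨N, fun k hk => ⟨congrArg (fun p : IRAPM.Pair n => p.fst) (hN k hk),
    congrArg (fun p : IRAPM.Pair n => p.snd) (hN k hk)⟩⟩
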